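/- Let $m\ge 1$, $\alpha>-1$, $c\ge 0$. Let $\mathbb{R}_m$ be the real Clifford algebra generated by $e_1,\dots,e_m$ with $e_j^2=-1$ and $e_ie_j=-e_je_i$ $(i\ne j)$, let $\lambda\mapsto\overline{\lambda}$ be the anti-automorphism with $\overline{e_j}=-e_j$, and identify $x\in\mathbb{R}^m$ with $\sum_j x_je_j\in\mathbb{R}_m$. Let $\partial_x=\sum_j e_j\partial_{x_j}$ be the Dirac operator, let $B(1)$ be the unit ball of $\mathbb{R}^m$, and let $$\mathcal{L}_{c,\alpha}f(x)=(1-|x|^2)^{-\alpha}\,\partial_x\big((1-|x|^2)^{\alpha+1}\partial_xf(x)\big)+4\pi^2c^2|x|^2f(x),\qquad x\in B(1).$$ For $k\ge 0$ let $M_l^+(k)$ be the right $\mathbb{R}_m$-module of the homogeneous polynomials $f:\mathbb{R}^m\to\mathbb{R}_m$ of degree $k$ with $\partial_xf=0$, let $d_{k,m}=\binom{m+k-2}{k}$ (with $d_{0,1}=1$ and $d_{k,1}=0$ for $k\ge1$), and let $Y_k^1,\dots,Y_k^{d_{k,m}}$ be an orthonormal basis of it: these functions span $M_l^+(k)$ over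 $\mathbb{R}_m$ from the right, and $\int_{S^{m-1}}\overline{Y_k^i(\omega)}\,Y_k^j(\omega)\,d\omega=\delta_{ij}$. The weighted Clifford prolate spheroidal wave functions (CPSWFs) are the following eigenfunctions of $\mathcal{L}_{c,\alpha}$ on $B(1)$. For $N\ge 0$, $\psi_{2N,m,\alpha}^{k,c,i}$ is a (not identically zero) eigenfunction of the form $P(|x|^2)\,Y_k^i(x)$ with $P\in C^\infty([0,1],\mathbb{R})$, whose eigenvalue is the $N$-th one (counted from $0$, in increasing order) among the real eigenvalues of eigenfunctions of this form; and $\psi_{2N+1,m,\alpha}^{k,c,i}$ is a (not identically zero) eigenfunction of the form $Q(|x|^2)\,x\,Y_k^i(x)$ with $Q\in C^\infty([0,1],\mathbb{R})$, whose eigenvalue is the $N$-th one among the real eigenvalues of eigenfunctions of that form. Then the even and the odd weighted CPSWFs are orthogonal with respect to the weight $(1-|x|^2)^\alpha$: for all $N,N'\ge0$, $k,k'\ge0$, $1\le i\le d_{k,m}$ and $1\le i'\le d_{k',m}$, the following integrand is integrable over $B(1)$ and $$\int_{B(1)}\overline{\psi_{2N,m,\alpha}^{k,c,i}(x)}\;\psi_{2N'+1,m,\alpha}^{k',c,i'}(x)\,(1-|x|^2)^\alpha\,dx=0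 .$$ -/

import Mathlib

open scoped ContDiff
open MeasureTheory

noncomputable section

namespace CPSWF

/-! ### The Clifford algebra of Euclidean space -/

/-- Euclidean space `ℝ^m`. -/
abbrev E (m : ℕ) : Type := EuclideanSpace ℝ (Fin m)

/-- The quadratic form `x ↦ -|x|²` on `ℝ^m`. -/
def negSq (m : ℕ) : QuadraticForm ℝ (E m) :=
  -(LinearMap.BilinMap.toQuadraticMap (innerₗ (E m)))

theorem negSq_apply (m : ℕ) (x : E m) : negSq m x = -‖x‖ ^ 2 := by
  simp [negSq, LinearMap.BilinMap.toQuadraticMap_apply]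

/-- The real Clifford algebra `ℝ_m`, generated by `ℝ^m` with `x * x = -|x|²`. Its Hermitian
conjugation (the anti-automorphism with `e_j ↦ -e_j`) is Mathlib's `star`. -/
abbrev Cl (m : ℕ) : Type := CliffordAlgebra (negSq m)

/-- The Clifford vector attached to a point of `ℝ^m`. -/
abbrev vec {m : ℕ} (x : E m) : Cl m := CliffordAlgebra.ι (negSq m) x

/-- The `j`-th standard basis vector of `ℝ^m`. -/
abbrev stdVec {m : ℕ} (j : Fin m) : E m := EuclideanSpace.single j (1 : ℝ)

/-- The generator `e_j` of `ℝ_m`. -/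
abbrev e {m : ℕ} (j : Fin m) : Cl m := vec (stdVec j)

theorem e_mul_self {m : ℕ} (j : Fin m) : (e j : Cl m) * e j = -1 := by
  rw [CliffordAlgebra.ι_sq_scalar, negSq_apply]
  simp

theorem e_mul_e {m : ℕ} {i j : Fin m} (h : i ≠ j) : (e j : Cl m) * e i = -(e i * e j) := by
  have h0 : QuadraticMap.polar (negSq m) (stdVec j) (stdVec i) = 0 := by
    simp [QuadraticMap.polar, negSq_apply, @norm_add_sq_real, EuclideanSpace.inner_single_left,
      h.symm]
  rw [eq_neg_iff_add_eq_zero, CliffordAlgebra.ι_mul_ι_add_swap, h0, map_zero]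

theorem star_e {m : ℕ} (j : Fin m) : star (e j : Cl m) = -e j := CliffordAlgebra.star_ι _

/-- The blades `e_A = e_{j₁} ⋯ e_{j_h}`, `A = {j₁ < ⋯ < j_h}`. -/
def blade {m : ℕ} (A : Finset (Fin m)) : Cl m := ((A.sort).map e).prod

/-- A basis of `ℝ_m`, obtained from that of the exterior algebra; it consists of the blades
(`bladeBasis_apply`). -/
def bladeBasis (m : ℕ) : Module.Basis (Finset (Fin m)) ℝ (Cl m) :=
  (EuclideanSpace.basisFun (Fin m) ℝ).toBasis.ExteriorAlgebra.map
    (CliffordAlgebra.equivExterior (negSq m)).symm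

theorem bladeBasis_apply {m : ℕ} (A : Finset (Fin m)) : bladeBasis m A = blade A := by
  have hB : ∀ i j : Fin m, i ≠ j →
      (QuadraticMap.associated (R := ℝ) (N := ℝ) (-(negSq m))) (stdVec i) (stdVec j) = 0 := by
    intro i j h
    simp [QuadraticMap.associated_apply, negSq_apply, @norm_add_sq_real,
      EuclideanSpace.inner_single_left, h]
  have h1 : ∀ (d : Module.Dual ℝ (E m)) (l : List (Fin m)),
      (∀ i ∈ l, d (stdVec i) = 0) →
      CliffordAlgebra.contractLeft (Q := (0 : QuadraticForm ℝ (E m))) d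
        ((l.map (fun i => CliffordAlgebra.ι (0 : QuadraticForm ℝ (E m)) (stdVec i))).prod) = 0 := by
    intro d l
    induction l with
    | nil => intro _; simp
    | cons a l ih =>
      intro hl
      rw [List.map_cons, List.prod_cons, CliffordAlgebra.contractLeft_ι_mul,
        ih (fun i hi => hl i (List.mem_cons_of_mem _ hi)), hl a List.mem_cons_self]
      simp
  have h2 : ∀ l : List (Fin m), l.Nodup →
      CliffordAlgebra.equivExterior (negSq m) ((l.map e).prod) =
        (l.map (fun i => CliffordAlgebra.ι (0 : QuadraticForm ℝ (E m)) (stdVec i))).prod := by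
    intro l
    induction l with
    | nil => intro _; simp [CliffordAlgebra.equivExterior, CliffordAlgebra.changeFormEquiv]
    | cons a l ih =>
      intro hl
      rw [List.nodup_cons] at hl
      have := ih hl.2
      simp only [CliffordAlgebra.equivExterior, CliffordAlgebra.changeFormEquiv_apply] at this ⊢
      rw [List.map_cons, List.prod_cons, CliffordAlgebra.changeForm_ι_mul, this, List.map_cons,
        List.prod_cons, h1, sub_zero]
      intro i hi
      exact hB a i (fun h => hl.1 (h ▸ hi))
  rw [bladeBasis, Module.Basis.map_apply, LinearEquiv.symm_apply_eq, blade,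
    h2 _ (Finset.sort_nodup _ _), ExteriorAlgebra.basis_apply_ofCard _ rfl,
    ExteriorAlgebra.ιMulti_family, ExteriorAlgebra.ιMulti_apply,
    ← Finset.listMap_orderEmbOfFin_finRange A rfl, List.map_map, List.ofFn_eq_map]
  congr 1
  refine List.map_congr_left fun i _ => ?_
  simp [Set.powersetCard.ofFinEmbEquiv_symm_apply]

/-- The coordinates `(λ_A)` of `λ = ∑ λ_A e_A`, as a vector of a Euclidean space. -/
def coords (m : ℕ) : Cl m →ₗ[ℝ] EuclideanSpace ℝ (Finset (Fin m)) :=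
  (WithLp.linearEquiv 2 ℝ (Finset (Fin m) → ℝ)).symm.toLinearMap ∘ₗ
    (bladeBasis m).equivFun.toLinearMap

theorem coords_injective (m : ℕ) : Function.Injective (coords m) :=
  (WithLp.linearEquiv 2 ℝ (Finset (Fin m) → ℝ)).symm.injective.comp
    (bladeBasis m).equivFun.injective

/-- The norm `|λ| = (∑ λ_A²)^(1/2)` on `ℝ_m`. -/
instance instNormedAddCommGroupCl (m : ℕ) : NormedAddCommGroup (Cl m) :=
  NormedAddCommGroup.induced (Cl m) (EuclideanSpace ℝ (Finset (Fin m))) (coords m)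
    (coords_injective m)

instance instNormedSpaceCl (m : ℕ) : NormedSpace ℝ (Cl m) :=
  NormedSpace.induced ℝ (Cl m) (EuclideanSpace ℝ (Finset (Fin m))) (coords m)

instance instFiniteDimensionalCl (m : ℕ) : FiniteDimensional ℝ (Cl m) :=
  Module.Finite.of_basis (bladeBasis m)

theorem norm_sq_eq {m : ℕ} (a : Cl m) : ‖a‖ ^ 2 = ∑ A, ((bladeBasis m).repr a A) ^ 2 := by
  change ‖coords m a‖ ^ 2 = _
  rw [EuclideanSpace.norm_sq_eq]
  simp [coords]

/-! ### Dirac operator and spherical monogenics -/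

/-- The Dirac operator `∂ₓ f = ∑ⱼ eⱼ ∂f/∂xⱼ`. -/
def dirac {m : ℕ} (f : E m → Cl m) (x : E m) : Cl m :=
  ∑ j : Fin m, e j * fderiv ℝ f x (stdVec j)

/-- `f : ℝ^m → ℝ_m` is a homogeneous polynomial map of degree `k`, i.e. all its coordinates
are homogeneous polynomials of degree `k`. -/
def IsHomogeneousPolynomialMap {m : ℕ} (k : ℕ) (f : E m → Cl m) : Prop :=
  ∀ A : Finset (Fin m), ∃ p : MvPolynomial (Fin m) ℝ, p.IsHomogeneous k ∧
    ∀ x : E m, (bladeBasis m).repr (f x) A = MvPolynomial.eval (fun j => x j) p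

/-- `M_l^+(k)`: the left solid inner spherical monogenics of order `k`, that is, the left
monogenic homogeneous polynomials of degree `k`. -/
def sphericalMonogenics (m k : ℕ) : Set (E m → Cl m) :=
  {f | IsHomogeneousPolynomialMap k f ∧ ∀ x, dirac f x = 0}

/-- The dimension `d_{k,m} = binom (m + k - 2) k` of `M_l^+(k)` as a right `ℝ_m`-module. (For
`m = 1` the truncated subtraction gives the right values `1, 0, 0, …`.) -/
def dimM (m k : ℕ) : ℕ := Nat.choose (m + k - 2) k

/-- `Y¹, …, Y^d` is an orthonormal basis of the right `ℝ_m`-module `M_l^+(k)`, for the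
`ℝ_m`-valued inner product given by integration over the unit sphere (with its surface
measure). -/
structure IsOrthonormalMonogenicBasis (m k : ℕ) (Y : Fin (dimM m k) → E m → Cl m) : Prop where
  mem : ∀ j, Y j ∈ sphericalMonogenics m k
  orthonormal : ∀ i j,
    ∫ s : Metric.sphere (0 : E m) 1, star (Y i s) * Y j s ∂(volume : Measure (E m)).toSphere
      = if i = j then 1 else 0
  spans : ∀ f ∈ sphericalMonogenics m k, ∃ a : Fin (dimM m k) → Cl m,
    ∀ x, f x = ∑ j, Y j x * a j

/-! ### Weighted Clifford prolate spheroidal wave functions -/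

/-- The operator
`𝓛_{c,α} f = (1-|x|²)^{-α} ∂ₓ((1-|x|²)^{α+1} ∂ₓ f) + 4π²c²|x|² f` (used on the unit ball). -/
def opL {m : ℕ} (c α : ℝ) (f : E m → Cl m) (x : E m) : Cl m :=
  (1 - ‖x‖ ^ 2) ^ (-α) • dirac (fun y => (1 - ‖y‖ ^ 2) ^ (α + 1) • dirac f y) x
    + (4 * Real.pi ^ 2 * c ^ 2 * ‖x‖ ^ 2) • f x

/-- `f` is an eigenfunction of `𝓛_{c,α}` on the unit ball, with eigenvalue `χ`. -/
def IsEigenfunction {m : ℕ} (c α χ : ℝ) (f : E m → Cl m) : Prop :=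
  (∃ x ∈ Metric.ball (0 : E m) 1, f x ≠ 0) ∧
    ∀ x ∈ Metric.ball (0 : E m) 1, opL c α f x = χ • f x

/-- The functions on the unit ball of the form `F(|x|²) Y(x)` with `F ∈ C^∞([0,1], ℝ)`. -/
def evenSpace {m : ℕ} (Y : E m → Cl m) : Set (E m → Cl m) :=
  {f | ∃ F : ℝ → ℝ, ContDiffOn ℝ ∞ F (Set.Icc 0 1) ∧
    ∀ x ∈ Metric.ball (0 : E m) 1, f x = F (‖x‖ ^ 2) • Y x}

/-- The functions on the unit ball of the form `G(|x|²) x Y(x)` with `G ∈ C^∞([0,1], ℝ)`. -/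
def oddSpace {m : ℕ} (Y : E m → Cl m) : Set (E m → Cl m) :=
  {f | ∃ G : ℝ → ℝ, ContDiffOn ℝ ∞ G (Set.Icc 0 1) ∧
    ∀ x ∈ Metric.ball (0 : E m) 1, f x = G (‖x‖ ^ 2) • (vec x * Y x)}

/-- `f` is an `N`-th eigenfunction (`N = 0, 1, …`) of `𝓛_{c,α}` within the class `X`: it is an
eigenfunction whose eigenvalue is preceded by exactly `N` smaller ones. -/
def IsNthEigenfunction {m : ℕ} (c α : ℝ) (X : Set (E m → Cl m)) (N : ℕ) (f : E m → Cl m) : Prop :=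
  f ∈ X ∧ ∃ χ : ℝ, IsEigenfunction c α χ f ∧
    {χ' : ℝ | χ' < χ ∧ ∃ g ∈ X, IsEigenfunction c α χ' g}.encard = N

/-- `ψ` is a weighted CPSWF `ψ_{n,m,α}^{k,c,i}`, where `Y = Y_k^i`: for `n = 2N` an `N`-th
eigenfunction of the form `P(|x|²) Y(x)`, for `n = 2N+1` an `N`-th eigenfunction of the form
`Q(|x|²) x Y(x)`. It is determined up to a nonzero real factor. -/
def IsWeightedCPSWF {m : ℕ} (c α : ℝ) (Y : E m → Cl m) (n : ℕ) (ψ : E m → Cl m) : Prop :=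
  (Even n ∧ IsNthEigenfunction c α (evenSpace Y) (n / 2) ψ) ∨
    (Odd n ∧ IsNthEigenfunction c α (oddSpace Y) (n / 2) ψ)

end CPSWF

end

/-! On the ball, `ψ = P(|x|²) Y` and `ψ' = Q(|x|²) x Y'` with `Y`, `Y'` monogenic and homogeneous of
degrees k and k'. The integrand is therefore a radial function times `Ȳ x Y'`, homogeneous of degree
k + k' + 1, and polar coordinates split off the factor `∫ Ȳ ω Y' dω` over the unit sphere
(`integral_norm_smul_homogeneous`).

That factor vanishes by Cauchy's theorem: ω is the outer normal, and the field `(Ȳ eⱼ Y')ⱼ` is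
divergence free since `∂ₓY = ∂ₓY' = 0` (`sum_fderiv_starMul_eq_zero`). Instead of a boundary
integral, the divergence is integrated over the whole space against a compactly supported radial C¹
function. Integration by parts gives `∫ max(1 - |x|², 0) Ȳ x Y' dx = 0`, and the same polar formula
reads this as a positive constant times the sphere integral. -/

namespace CPSWF

/-! ### Polar coordinates and radial integrals -/

section Polar

variable {V F : Type*} [NormedAddCommGroup V] [NormedSpace ℝ V] [MeasurableSpace V] [BorelSpace V]
  [FiniteDimensional ℝ V] [Nontrivial V] [NormedAddCommGroup F] [NormedSpace ℝ F]

/-- Polar coordinates for the product of a radial function and a homogeneous one. -/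
theorem integral_norm_smul_homogeneous (μ : Measure V) [μ.IsAddHaarMeasure] (w : ℝ → ℝ) (d : ℕ)
    (H : V → F) (hH : ∀ (r : ℝ) (x : V), H (r • x) = r ^ d • H x) :
    ∫ x, w ‖x‖ • H x ∂μ =
      (∫ r in Set.Ioi (0 : ℝ), r ^ (Module.finrank ℝ V - 1) * (w r * r ^ d)) •
        ∫ s : Metric.sphere (0 : V) 1, H s ∂μ.toSphere := by
  calc
    ∫ x, w ‖x‖ • H x ∂μ = ∫ x : ({(0)}ᶜ : Set V), w ‖x.1‖ • H x.1 ∂(μ.comap (↑)) := by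
      rw [integral_subtype_comap (measurableSet_singleton _).compl fun x ↦ w ‖x‖ • H x,
        restrict_compl_singleton]
    _ = ∫ p : Metric.sphere (0 : V) 1 × Set.Ioi (0 : ℝ), (w p.2 * (p.2 : ℝ) ^ d) • H p.1
          ∂μ.toSphere.prod (.volumeIoiPow (Module.finrank ℝ V - 1)) := by
      rw [← μ.measurePreserving_homeomorphUnitSphereProd.integral_comp
        (Homeomorph.measurableEmbedding _)]
      refine integral_congr_ae (.of_forall fun x => ?_)
      have hx : ‖x.1‖ ≠ 0 := norm_ne_zero_iff.2 x.2
      have : H x.1 = ‖x.1‖ ^ d • H (‖x.1‖⁻¹ • x.1) := by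
        rw [← hH, smul_smul, mul_inv_cancel₀ hx, one_smul]
      simp only [homeomorphUnitSphereProd_apply_snd_coe, homeomorphUnitSphereProd_apply_fst_coe]
      rw [mul_smul, ← this]
    _ = (∫ r : Set.Ioi (0 : ℝ), w r * (r : ℝ) ^ d ∂.volumeIoiPow (Module.finrank ℝ V - 1)) •
          ∫ s : Metric.sphere (0 : V) 1, H s ∂μ.toSphere := by
      -- The product formula needs no integrability, so `w` may be arbitrary.
      rw [← integral_prod_swap, ← integral_prod_smul]
      rfl
    _ = _ := by
      congr 1
      simp only [Measure.volumeIoiPow, ENNReal.ofReal]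
      rw [integral_withDensity_eq_integral_smul, integral_subtype_comap measurableSet_Ioi
          fun a : ℝ ↦ Real.toNNReal (a ^ (Module.finrank ℝ V - 1)) • (w a * a ^ d),
        setIntegral_congr_fun measurableSet_Ioi fun x hx ↦ ?_]
      · rw [NNReal.smul_def, Real.coe_toNNReal _ (pow_nonneg (le_of_lt hx) _), smul_eq_mul]
      · exact (measurable_subtype_coe.pow_const _).real_toNNReal

end Polar

/-- Provides the nonzero radial constant that is cancelled to reach the sphere integral. -/
theorem integral_pow_mul_max_pos (n : ℕ) :
    0 < ∫ r in Set.Ioi (0 : ℝ), r ^ n * max (1 - r ^ 2) 0 := by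
  have hc : Continuous fun r : ℝ => r ^ n * max (1 - r ^ 2) 0 := by fun_prop
  have hi : Integrable fun r : ℝ => r ^ n * max (1 - r ^ 2) 0 := by
    refine hc.integrable_of_hasCompactSupport
      (HasCompactSupport.intro (isCompact_Icc (a := (-1 : ℝ)) (b := 1)) fun r hr => ?_)
    have : 1 - r ^ 2 ≤ 0 := by
      by_contra! h
      exact hr (abs_le.1 ((sq_le_one_iff_abs_le_one r).1 (by linarith)))
    rw [max_eq_right this, mul_zero]
  rw [setIntegral_pos_iff_support_of_nonneg_ae _ hi.integrableOn]
  · refine lt_of_lt_of_le ?_ (measure_mono (s := Set.Ioo (0 : ℝ) 1) fun r hr => ⟨?_, hr.1⟩)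
    · simp
    · have h1 : 0 < 1 - r ^ 2 := by nlinarith [hr.1, hr.2]
      rw [Function.mem_support, max_eq_left h1.le]
      exact (mul_pos (pow_pos hr.1 _) h1).ne'
  · refine ae_restrict_of_forall_mem measurableSet_Ioi fun r hr => ?_
    exact mul_nonneg (pow_nonneg (le_of_lt hr) _) (le_max_right _ _)

/-- In the radial variable, `1 - r² = (1 + r)(1 - r)`: the factor `(1 + r)^α` is bounded on [0,1],
and `(1 - r)^α` is integrable at 1 because α > -1. -/
theorem integrableOn_one_sub_norm_sq_rpow {m : ℕ} (hm : 1 ≤ m) {α : ℝ} (hα : -1 < α) :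
    IntegrableOn (fun x : E m => (1 - ‖x‖ ^ 2) ^ α) (Metric.ball 0 1) := by
  have : Nonempty (Fin m) := ⟨⟨0, hm⟩⟩
  have : Nontrivial (E m) := inferInstance
  refine (integrableOn_fun_norm_addHaar (E := E m) volume (f := fun r => (1 - r ^ 2) ^ α)).2 ?_
  have h1 : IntegrableOn (fun r : ℝ => (1 - r) ^ α) (Set.Ioo 0 1) := by
    have h := (intervalIntegral.intervalIntegrable_rpow' (a := 0) (b := 1) hα).comp_sub_left 1
    simp only [sub_zero, sub_self] at h
    exact ((intervalIntegrable_iff_integrableOn_Ioc_of_le zero_le_one).1 h.symm).mono_set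
      Set.Ioo_subset_Ioc_self
  have h2 : ContinuousOn (fun r : ℝ => r ^ (Module.finrank ℝ (E m) - 1) * (1 + r) ^ α)
      (Set.Icc 0 1) := by
    refine ContinuousOn.mul (by fun_prop) (ContinuousOn.rpow_const (by fun_prop) ?_)
    intro r hr
    left
    linarith [hr.1]
  obtain ⟨C, hC⟩ := isCompact_Icc.exists_bound_of_continuousOn h2
  have h3 : IntegrableOn
      (fun r : ℝ => (r ^ (Module.finrank ℝ (E m) - 1) * (1 + r) ^ α) * (1 - r) ^ α)
      (Set.Ioo 0 1) := by
    refine Integrable.bdd_mul (c := C) h1 ?_ ?_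
    · exact (h2.mono Set.Ioo_subset_Icc_self).aestronglyMeasurable measurableSet_Ioo
    · exact ae_restrict_of_forall_mem measurableSet_Ioo
        fun r hr => hC r (Set.Ioo_subset_Icc_self hr)
  refine h3.congr_fun (fun r hr => ?_) measurableSet_Ioo
  have : (1 - r ^ 2 : ℝ) = (1 + r) * (1 - r) := by ring
  simp only [smul_eq_mul]
  rw [this, Real.mul_rpow (by linarith [hr.1]) (by linarith [hr.2]), mul_assoc]

/-! ### Smoothness and homogeneity of polynomial maps -/

theorem contDiff_eval {m : ℕ} (p : MvPolynomial (Fin m) ℝ) {n : WithTop ℕ∞} :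
    ContDiff ℝ n fun x : E m => MvPolynomial.eval (fun j => x j) p := by
  induction p using MvPolynomial.induction_on with
  | C a => simpa using contDiff_const
  | add p q hp hq => simpa using hp.add hq
  | mul_X p i hp =>
    have : ContDiff ℝ n fun x : E m => x i := by fun_prop
    simpa using hp.mul this

theorem IsHomogeneousPolynomialMap.contDiff {m k : ℕ} {f : E m → Cl m}
    (hf : IsHomogeneousPolynomialMap k f) {n : WithTop ℕ∞} : ContDiff ℝ n f := by
  choose p _ hp using hf
  have : f = fun x => ∑ A, MvPolynomial.eval (fun j => x j) (p A) • bladeBasis m A := by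
    funext x
    simp_rw [← hp]
    exact ((bladeBasis m).sum_repr (f x)).symm
  rw [this]
  exact ContDiff.sum fun A _ => (contDiff_eval (p A)).smul contDiff_const

theorem IsHomogeneousPolynomialMap.map_smul {m k : ℕ} {f : E m → Cl m}
    (hf : IsHomogeneousPolynomialMap k f) (r : ℝ) (x : E m) : f (r • x) = r ^ k • f x := by
  refine (bladeBasis m).repr.injective (Finsupp.ext fun A => ?_)
  obtain ⟨p, hp, h⟩ := hf A
  rw [h, _root_.map_smul, Finsupp.smul_apply, h, smul_eq_mul, MvPolynomial.eval_eq,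
    MvPolynomial.eval_eq, Finset.mul_sum]
  refine Finset.sum_congr rfl fun d hd => ?_
  have hk : ∑ i ∈ d.support, d i = k := by
    simpa [Finsupp.weight_apply, Finsupp.sum] using hp (MvPolynomial.mem_support_iff.1 hd)
  simp only [PiLp.smul_apply, smul_eq_mul, mul_pow, Finset.prod_mul_distrib,
    Finset.prod_pow_eq_pow_sum, hk]
  ring

/-! ### Clifford products as linear and bilinear maps, continuous by finite dimension -/

/-- The sesquilinear product `(a, b) ↦ ā b` of the Clifford algebra. -/
noncomputable def starMul (m : ℕ) : Cl m →L[ℝ] Cl m →L[ℝ] Cl m :=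
  LinearMap.toContinuousBilinearMap <| LinearMap.mk₂ ℝ (fun a b => star a * b)
    (by simp [add_mul]) (by simp) (by simp [mul_add]) (by simp)

theorem starMul_apply {m : ℕ} (a b : Cl m) : starMul m a b = star a * b := rfl

/-- Left Clifford multiplication. -/
noncomputable def mulLeftCLM {m : ℕ} (a : Cl m) : Cl m →L[ℝ] Cl m :=
  LinearMap.toContinuousLinearMap (LinearMap.mulLeft ℝ a)

theorem vec_eq_sum {m : ℕ} (x : E m) : (vec x : Cl m) = ∑ j, x j • e j := by
  conv_lhs => rw [← (EuclideanSpace.basisFun (Fin m) ℝ).sum_repr x]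
  simp [map_sum, e, stdVec]

theorem continuous_vec {m : ℕ} : Continuous (vec : E m → Cl m) :=
  (CliffordAlgebra.ι (negSq m)).continuous_of_finiteDimensional

/-! ### Integration by parts against a radial cutoff -/

/-- The primitive of `t ↦ max (1 - t) 0`, vanishing for `s ≥ 1`. -/
noncomputable def cutoff (s : ℝ) : ℝ := ∫ t in (1 : ℝ)..s, max (1 - t) 0

theorem hasDerivAt_cutoff (s : ℝ) : HasDerivAt cutoff (max (1 - s) 0) s := by
  have hc : Continuous fun t : ℝ => max (1 - t) 0 := by fun_prop
  exact intervalIntegral.integral_hasDerivAt_right (hc.intervalIntegrable _ _)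
    (hc.stronglyMeasurableAtFilter _ _) hc.continuousAt

theorem cutoff_eq_zero {s : ℝ} (hs : 1 ≤ s) : cutoff s = 0 := by
  refine intervalIntegral.integral_zero_ae (.of_forall fun t ht => ?_)
  rw [Set.uIoc_of_le hs] at ht
  exact max_eq_right (by linarith [ht.1])

theorem hasFDerivAt_cutoff_norm_sq {m : ℕ} (x : E m) :
    HasFDerivAt (fun y : E m => cutoff (‖y‖ ^ 2))
      (max (1 - ‖x‖ ^ 2) 0 • (2 • innerSL ℝ x)) x :=
  (hasDerivAt_cutoff _).comp_hasFDerivAt x (hasStrictFDerivAt_norm_sq x).hasFDerivAt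

/-- There is no boundary term: `cutoff (‖x‖ ^ 2)` is C¹, vanishes outside the unit ball, and has
gradient `2 max(1 - |x|², 0) x`. -/
theorem integral_cutoff_smul_fderiv {m : ℕ} {F : Type*} [NormedAddCommGroup F] [NormedSpace ℝ F]
    {G : E m → F} (hG : ContDiff ℝ 1 G) (j : Fin m) :
    Integrable (fun x : E m => max (1 - ‖x‖ ^ 2) 0 • (x j • G x)) ∧
    Integrable (fun x : E m => cutoff (‖x‖ ^ 2) • fderiv ℝ G x (stdVec j)) ∧
    ∫ x : E m, cutoff (‖x‖ ^ 2) • fderiv ℝ G x (stdVec j) =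
      (-2 : ℝ) • ∫ x : E m, max (1 - ‖x‖ ^ 2) 0 • (x j • G x) := by
  have hK : IsCompact (Metric.closedBall (0 : E m) 1) := isCompact_closedBall _ _
  have hout : ∀ x ∉ Metric.closedBall (0 : E m) 1, 1 ≤ ‖x‖ ^ 2 := by
    intro x hx
    rw [mem_closedBall_zero_iff, not_le] at hx
    nlinarith
  have hcont : Continuous fun x : E m => cutoff (‖x‖ ^ 2) :=
    continuous_iff_continuousAt.2 fun x => (hasFDerivAt_cutoff_norm_sq x).continuousAt
  have hfd : Continuous fun x => fderiv ℝ G x (stdVec j) :=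
    (hG.continuous_fderiv one_ne_zero).clm_apply continuous_const
  have hGc := hG.continuous
  have hd : ∀ x : E m, fderiv ℝ (fun y : E m => cutoff (‖y‖ ^ 2)) x (stdVec j) =
      2 * (max (1 - ‖x‖ ^ 2) 0 * x j) := by
    intro x
    rw [(hasFDerivAt_cutoff_norm_sq x).fderiv]
    simp [EuclideanSpace.inner_single_right]
    ring
  have i1 : Integrable (fun x : E m => max (1 - ‖x‖ ^ 2) 0 • (x j • G x)) := by
    refine Continuous.integrable_of_hasCompactSupport (by fun_prop)
      (HasCompactSupport.intro hK fun x hx => ?_)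
    rw [max_eq_right (by linarith [hout x hx]), zero_smul]
  have i2 : Integrable (fun x : E m => cutoff (‖x‖ ^ 2) • fderiv ℝ G x (stdVec j)) := by
    refine Continuous.integrable_of_hasCompactSupport (hcont.smul hfd)
      (HasCompactSupport.intro hK fun x hx => ?_)
    rw [cutoff_eq_zero (hout x hx), zero_smul]
  have i3 : Integrable (fun x : E m => cutoff (‖x‖ ^ 2) • G x) := by
    refine Continuous.integrable_of_hasCompactSupport (hcont.smul hGc)
      (HasCompactSupport.intro hK fun x hx => ?_)
    rw [cutoff_eq_zero (hout x hx), zero_smul]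
  have hd' : (fun x : E m => fderiv ℝ (fun y : E m => cutoff (‖y‖ ^ 2)) x (stdVec j) • G x) =
      fun x => (2 : ℝ) • (max (1 - ‖x‖ ^ 2) 0 • (x j • G x)) := by
    funext x
    rw [hd, smul_smul, smul_smul, mul_assoc]
  refine ⟨i1, i2, ?_⟩
  rw [integral_smul_fderiv_eq_neg_fderiv_smul_of_integrable _ i2 i3
    (fun x _ => (hasFDerivAt_cutoff_norm_sq x).differentiableAt)
    (fun x _ => (hG.differentiable one_ne_zero) x), hd', integral_smul, neg_smul]
  rw [hd']
  exact i1.smul (2 : ℝ)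

/-- A vanishing divergence forces a radially weighted flux to vanish. -/
theorem integral_max_smul_flux_eq_zero {m : ℕ} {F : Type*} [NormedAddCommGroup F]
    [NormedSpace ℝ F] {G : Fin m → E m → F} (hG : ∀ j, ContDiff ℝ 1 (G j))
    (hdiv : ∀ x, ∑ j, fderiv ℝ (G j) x (stdVec j) = 0) :
    ∫ x : E m, max (1 - ‖x‖ ^ 2) 0 • ∑ j, x j • G j x = 0 := by
  have h0 : ∑ j, ∫ x : E m, cutoff (‖x‖ ^ 2) • fderiv ℝ (G j) x (stdVec j) = 0 := by
    rw [← integral_finsetSum _ fun j _ => (integral_cutoff_smul_fderiv (hG j) j).2.1]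
    simp_rw [← Finset.smul_sum, hdiv, smul_zero, integral_zero]
  simp_rw [fun j => (integral_cutoff_smul_fderiv (hG j) j).2.2, ← Finset.smul_sum] at h0
  rw [← integral_finsetSum _ fun j _ => (integral_cutoff_smul_fderiv (hG j) j).1] at h0
  simpa only [Finset.smul_sum] using (smul_eq_zero.1 h0).resolve_left (by norm_num)

/-- The conjugated Dirac equation, in divergence form. -/
theorem sum_fderiv_starMul_eq_zero {m : ℕ} {f g : E m → Cl m} (hf : Differentiable ℝ f)
    (hg : Differentiable ℝ g) (hf0 : ∀ x, dirac f x = 0) (hg0 : ∀ x, dirac g x = 0) (x : E m) :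
    ∑ j, fderiv ℝ (fun y => starMul m (f y) (e j * g y)) x (stdVec j) = 0 := by
  -- Leibniz rule; since `star (e j) = -e j`, the factor `e j` moves into the conjugate of the
  -- derivative of `f` at the price of a sign. Summing over j then produces the two Dirac operators.
  have h : ∀ j : Fin m, fderiv ℝ (fun y => starMul m (f y) (e j * g y)) x (stdVec j) =
      star (f x) * (e j * fderiv ℝ g x (stdVec j)) -
        star (e j * fderiv ℝ f x (stdVec j)) * g x := by
    intro j
    have h1 : HasFDerivAt (fun y => e j * g y) ((mulLeftCLM (e j)).comp (fderiv ℝ g x)) x :=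
      (mulLeftCLM (e j)).hasFDerivAt.comp x (hg x).hasFDerivAt
    have h2 := (starMul m).hasFDerivAt_of_bilinear (hf x).hasFDerivAt h1
    rw [h2.fderiv]
    simp [starMul_apply, mulLeftCLM, mul_assoc]
  simp_rw [h, Finset.sum_sub_distrib, ← Finset.mul_sum, ← Finset.sum_mul, ← star_sum]
  change star (f x) * dirac g x - star (dirac f x) * g x = 0
  rw [hf0, hg0]
  simp

theorem star_mul_vec_mul_smul {m k l : ℕ} {f g : E m → Cl m}
    (hf : IsHomogeneousPolynomialMap k f) (hg : IsHomogeneousPolynomialMap l g) (r : ℝ)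
    (x : E m) : star (f (r • x)) * (vec (r • x) * g (r • x)) =
      r ^ (k + l + 1) • (star (f x) * (vec x * g x)) := by
  rw [hf.map_smul, hg.map_smul, vec, map_smul]
  simp only [CliffordAlgebra.star_smul, smul_mul_assoc, mul_smul_comm, smul_smul]
  congr 1
  ring

/-- The radial flux of the field `f̄ eⱼ g` is `∑ xⱼ f̄ eⱼ g = f̄ x g`. -/
theorem integral_max_smul_star_mul_vec_mul_eq_zero {m : ℕ} {f g : E m → Cl m}
    (hf : ContDiff ℝ 1 f) (hg : ContDiff ℝ 1 g) (hf0 : ∀ x, dirac f x = 0)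
    (hg0 : ∀ x, dirac g x = 0) :
    ∫ x : E m, max (1 - ‖x‖ ^ 2) 0 • (star (f x) * (vec x * g x)) = 0 := by
  have hG : ∀ j : Fin m, ContDiff ℝ 1 fun y => starMul m (f y) (e j * g y) := by
    intro j
    have h1 : ContDiff ℝ 1 fun y => e j * g y := (mulLeftCLM (e j)).contDiff.comp hg
    exact ((starMul m).contDiff.comp hf).clm_apply h1
  rw [← integral_max_smul_flux_eq_zero hG (sum_fderiv_starMul_eq_zero
    (hf.differentiable one_ne_zero) (hg.differentiable one_ne_zero) hf0 hg0)]
  refine integral_congr_ae (.of_forall fun x => ?_)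
  simp only [starMul_apply]
  rw [vec_eq_sum, Finset.sum_mul, Finset.mul_sum]
  simp only [smul_mul_assoc, mul_smul_comm]

/-- Cauchy's theorem on the unit sphere. -/
theorem integral_sphere_star_vec_mul_eq_zero {m : ℕ} (hm : 1 ≤ m) {k l : ℕ} {f g : E m → Cl m}
    (hf : f ∈ sphericalMonogenics m k) (hg : g ∈ sphericalMonogenics m l) :
    ∫ s : Metric.sphere (0 : E m) 1, star (f s) * (vec (s : E m) * g s)
      ∂(volume : Measure (E m)).toSphere = 0 := by
  have : Nonempty (Fin m) := ⟨⟨0, hm⟩⟩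
  have : Nontrivial (E m) := inferInstance
  have hp := integral_norm_smul_homogeneous volume (fun r => max (1 - r ^ 2) 0) (k + l + 1)
    (fun x : E m => star (f x) * (vec x * g x)) (star_mul_vec_mul_smul hf.1 hg.1)
  rw [integral_max_smul_star_mul_vec_mul_eq_zero hf.1.contDiff hg.1.contDiff hf.2 hg.2] at hp
  refine (smul_eq_zero.1 hp.symm).resolve_left ?_
  have h := (integral_pow_mul_max_pos (Module.finrank ℝ (E m) - 1 + (k + l + 1))).ne'
  simpa only [pow_add, mul_assoc, mul_comm, mul_left_comm] using h

/-- Whatever the radial profile, the angular factor is the vanishing sphere integral. -/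
theorem integral_ball_star_vec_mul_eq_zero {m : ℕ} (hm : 1 ≤ m) {k l : ℕ} {f g : E m → Cl m}
    (hf : f ∈ sphericalMonogenics m k) (hg : g ∈ sphericalMonogenics m l) (w : ℝ → ℝ) :
    ∫ x in Metric.ball (0 : E m) 1, w ‖x‖ • (star (f x) * (vec x * g x)) = 0 := by
  have : Nonempty (Fin m) := ⟨⟨0, hm⟩⟩
  have : Nontrivial (E m) := inferInstance
  -- The restriction to the ball is itself radial, so it is absorbed into the profile.
  have hp := integral_norm_smul_homogeneous volume ((Set.Iio 1).indicator w) (k + l + 1)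
    (fun x : E m => star (f x) * (vec x * g x)) (star_mul_vec_mul_smul hf.1 hg.1)
  rw [integral_sphere_star_vec_mul_eq_zero hm hf hg, smul_zero] at hp
  rw [← integral_indicator Metric.isOpen_ball.measurableSet, ← hp]
  refine integral_congr_ae (.of_forall fun x => ?_)
  by_cases hx : ‖x‖ < 1 <;> simp [Set.indicator, hx]

end CPSWF

theorem mainTheorem4 (m : ℕ) (hm : 1 ≤ m) (α c : ℝ) (hα : -1 < α) (hc : 0 ≤ c)
    (Y : ∀ k : ℕ, Fin (CPSWF.dimM m k) → CPSWF.E m → CPSWF.Cl m)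
    (hY : ∀ k : ℕ, CPSWF.IsOrthonormalMonogenicBasis m k (Y k))
    (N N' k k' : ℕ) (i : Fin (CPSWF.dimM m k)) (i' : Fin (CPSWF.dimM m k'))
    (ψ ψ' : CPSWF.E m → CPSWF.Cl m)
    (hψ : CPSWF.IsWeightedCPSWF c α (Y k i) (2 * N) ψ)
    (hψ' : CPSWF.IsWeightedCPSWF c α (Y k' i') (2 * N' + 1) ψ') :
    MeasureTheory.IntegrableOn
        (fun x : CPSWF.E m => (1 - ‖x‖ ^ 2) ^ α • (star (ψ x) * ψ' x)) (Metric.ball 0 1) ∧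
      ∫ x in Metric.ball (0 : CPSWF.E m) 1, (1 - ‖x‖ ^ 2) ^ α • (star (ψ x) * ψ' x) = 0 := by
  obtain ⟨⟨P, hP, hPψ⟩, -⟩ : CPSWF.IsNthEigenfunction c α (CPSWF.evenSpace (Y k i)) N ψ := by
    rcases hψ with ⟨-, h⟩ | ⟨h, -⟩
    · simpa using h
    · exact absurd h (by simp)
  obtain ⟨⟨Q, hQ, hQψ⟩, -⟩ : CPSWF.IsNthEigenfunction c α (CPSWF.oddSpace (Y k' i')) N' ψ' := by
    rcases hψ' with ⟨h, -⟩ | ⟨-, h⟩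
    · exact absurd h (by simp)
    · rwa [show (2 * N' + 1) / 2 = N' by omega] at h
  have hf := (hY k).mem i
  have hg := (hY k').mem i'
  have hB : MeasurableSet (Metric.ball (0 : CPSWF.E m) 1) := Metric.isOpen_ball.measurableSet
  have hEq : ∀ x ∈ Metric.ball (0 : CPSWF.E m) 1, (1 - ‖x‖ ^ 2) ^ α • (star (ψ x) * ψ' x) =
      (1 - ‖x‖ ^ 2) ^ α • ((P (‖x‖ ^ 2) * Q (‖x‖ ^ 2)) •
        (star (Y k i x) * (CPSWF.vec x * Y k' i' x))) := by
    intro x hx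
    rw [hPψ x hx, hQψ x hx, CliffordAlgebra.star_smul, smul_mul_smul_comm]
  constructor
  -- The weight is integrable; the other factor extends continuously to the closed ball, hence is
  -- bounded.
  · refine IntegrableOn.congr_fun ?_ (fun x hx => (hEq x hx).symm) hB
    have hmaps : Set.MapsTo (fun x : CPSWF.E m => ‖x‖ ^ 2) (Metric.closedBall 0 1)
        (Set.Icc 0 1) := by
      intro x hx
      rw [mem_closedBall_zero_iff] at hx
      exact ⟨by positivity, pow_le_one₀ (norm_nonneg x) hx⟩
    have hH : Continuous fun x : CPSWF.E m =>
        star (Y k i x) * (CPSWF.vec x * Y k' i' x) := by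
      have h1 : Continuous fun x : CPSWF.E m => CPSWF.vec x * Y k' i' x :=
        (LinearMap.toContinuousBilinearMap (LinearMap.mul ℝ (CPSWF.Cl m))).continuous₂.comp
          (CPSWF.continuous_vec.prodMk (hg.1.contDiff (n := 0)).continuous)
      exact (CPSWF.starMul m).continuous₂.comp
        ((hf.1.contDiff (n := 0)).continuous.prodMk h1)
    have hcont : ContinuousOn (fun x : CPSWF.E m => (P (‖x‖ ^ 2) * Q (‖x‖ ^ 2)) •
        (star (Y k i x) * (CPSWF.vec x * Y k' i' x))) (Metric.closedBall 0 1) :=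
      ((hP.continuousOn.comp (by fun_prop) hmaps).mul
        (hQ.continuousOn.comp (by fun_prop) hmaps)).smul hH.continuousOn
    obtain ⟨C, hC⟩ := (isCompact_closedBall (0 : CPSWF.E m) 1).exists_bound_of_continuousOn hcont
    refine Integrable.smul_bdd (C := C) (CPSWF.integrableOn_one_sub_norm_sq_rpow hm hα) ?_ ?_
    · exact (hcont.mono Metric.ball_subset_closedBall).aestronglyMeasurable hB
    · exact ae_restrict_of_forall_mem hB fun x hx => hC x (Metric.ball_subset_closedBall hx)
  · rw [setIntegral_congr_fun hB hEq]
    simp_rw [smul_smul]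
    exact CPSWF.integral_ball_star_vec_mul_eq_zero hm hf hg
      fun r => (1 - r ^ 2) ^ α * (P (r ^ 2) * Q (r ^ 2))
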